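/- Let $R$ be a discrete valuation ring with uniformizer $\pi$, fraction field $K$ and valuation $v$ (normalized by $v(\pi)=1$, with $v(0)=\infty$). Let $f(x)=x^2-ax-b\in R[x]$ be irreducible, let $\theta$ be a root of $f$ (the class of $x$ in $R[x]/(f)$), and let $\mathcal O=R[\theta]\cong R[x]/(f)$. Two non-zero ideals $J_1,J_2$ of $\mathcal O$ are called equivalent if $\alpha_1J_1=\alpha_2J_2$ for some non-zero $\alpha_1,\alpha_2\in\mathcal O$; the equivalence classes are the ideal classes of $\mathcal O$, and their number is the class number of $\mathcal O$. We say that the ideal classes are given by a list of modules if every module in the list is a non-zero ideal of $\mathcal O$ and every ideal class contains exactly one member of the list. "Separable" means separable as a polynomial over $K$. Then the class number of $\mathcal O$ is finite, unless $\operatorname{char}(K)=2$ and $f$ is inseparable. More precisely: 1. If $2\in R^\times$, put $\Delta=\frac{a^2}{4}+b$. Then $v(\Delta)<\infty$ and the ideal classes are given by $$R\pi^k\oplus R\left(\theta-\tfrac a2\right),\qquad 0\le k\le\tfrac12v(\Delta);$$ the class number is $\lfloor\frac12v(\Delta)\rfloor+1$. 2. Suppose $0<e:=v(2)<\infty$.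 (i) If $v(a)<e$, let $m$ be the maximal integer in $\{0,1,\dots,v(a)\}$ such that $v(b-r(r+a))\ge2m$ for some $r\in R$. For every such $r$ (for this $m$), the ideal classes are given by $$R\pi^k\oplus R(r+\theta),\qquad 0\le k\le m;$$ the class number is $m+1$. (ii) If $v(a)\ge e$, then $\frac a2\in R$; put $\Delta=\left(\frac a2\right)^2+b\in R$. Then $(\theta-\frac a2)^2=\Delta$ and $v(\Delta)<\infty$. - If $v(\Delta)$ is odd, the ideal classes are given by $$R\pi^k\oplus R\left(\theta-\tfrac a2\right),\qquad 0\le k\le\left\lfloor\tfrac12v(\Delta)\right\rfloor;$$ the class number is $\lfloor\frac12v(\Delta)\rfloor+1$. - If $v(\Delta)$ is even, let $m$ be the maximal integer in $\{0,1,\dots,e\}$ such that $v(\Delta-r^2)\ge2m+v(\Delta)$ for some $r\in R$. For every such $r$ (for this $m$), the ideal classes are given by $$R\pi^k\oplus R\left(\theta-\tfrac a2\right),\quad 0\le k\le\tfrac12v(\Delta),\qquad\text{and}\qquad R\pi^{\frac12v(\Delta)+i}\oplus R\left(r+\theta-\tfrac a2\right),\quad 1\le i\le m;$$ the class number is $\frac12v(\Delta)+m+1$.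 3. Suppose $2=0$ in $R$. (i) If $f$ is separable, let $m$ be the maximal integer in $\{0,1,\dots,v(a)\}$ such that $v(b-r(r+a))\ge2m$ for some $r\in R$. For every such $r$ (for this $m$), the ideal classes are given by $$R\pi^k\oplus R(r+\theta),\qquad 0\le k\le m;$$ the class number is $m+1$. (ii) If $f$ is inseparable, then $a=0$ and $b=\theta^2$. Let $I$ be the set of all integers $i\ge0$ for which the conditions $u^2+s\pi^i=b$, $v(s)\ge i$ have a solution $u,s\in R$, and fix a solution $(u_i,s_i)$ for each $i\in I$. Then the ideal classes are given by $$Rs_i\oplus R(u_i+\theta),\qquad i\in I.$$ The class number is infinite if and only if $I$ contains every integer $i\ge0$. -/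

import Mathlib

open Polynomial

/-- Two ideals `J₁, J₂` are equivalent if `α₁ J₁ = α₂ J₂` for some non-zero-divisors `α₁, α₂`
(in a domain: for some non-zero `α₁, α₂`). -/
def IdealEquiv {S : Type*} [CommRing S] (J₁ J₂ : Ideal S) : Prop :=
  ∃ α₁ ∈ nonZeroDivisors S, ∃ α₂ ∈ nonZeroDivisors S,
    Ideal.span {α₁} * J₁ = Ideal.span {α₂} * J₂

/-- Equivalence of non-zero ideals. -/
def idealSetoid (S : Type*) [CommRing S] : Setoid {J : Ideal S // J ≠ ⊥} where
  r J₁ J₂ := IdealEquiv J₁.1 J₂.1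
  iseqv :=
    { refl := fun _ => ⟨1, one_mem _, 1, one_mem _, rfl⟩
      symm := fun ⟨α, hα, β, hβ, h⟩ => ⟨β, hβ, α, hα, h.symm⟩
      trans := by
        rintro J₁ J₂ J₃ ⟨α, hα, β, hβ, h⟩ ⟨γ, hγ, δ, hδ, h'⟩
        refine ⟨γ * α, mul_mem hγ hα, β * δ, mul_mem hβ hδ, ?_⟩
        rw [← Ideal.span_singleton_mul_span_singleton, ← Ideal.span_singleton_mul_span_singleton,
          mul_assoc, h, mul_assoc, ← h', mul_left_comm] }

/-- The set of ideal classes of non-zero (not necessarily invertible) ideals of `S`. -/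
def IdealClasses (S : Type*) [CommRing S] : Type _ := Quotient (idealSetoid S)

/-- The class of a non-zero ideal. -/
def idealClass {S : Type*} [CommRing S] (J : {J : Ideal S // J ≠ ⊥}) : IdealClasses S :=
  Quotient.mk (idealSetoid S) J

/-- The ideal `J` of the `R`-algebra `S` is `R x ⊕ R y`, with `x, y` linearly independent. -/
def IsDirectSum (R : Type*) {S : Type*} [CommRing R] [CommRing S] [Algebra R S]
    (J : Ideal S) (x y : S) : Prop :=
  (J : Set S) = (Submodule.span R {x, y} : Set S) ∧ LinearIndependent R ![x, y]

/-- The modules `R x_i ⊕ R y_i` are non-zero ideals of `S`, and every ideal class of `S` is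
represented by exactly one of them. -/
def AreAllIdealClasses (R : Type*) {S : Type*} [CommRing R] [CommRing S] [Algebra R S]
    {ι : Type*} (x y : ι → S) : Prop :=
  ∃ J : ι → {J : Ideal S // J ≠ ⊥},
    (∀ i, IsDirectSum R (J i).1 (x i) (y i)) ∧
    Function.Bijective (fun i => idealClass (J i))

/-- The class number of `S` is finite and equal to `n`. -/
def HasClassNumber (S : Type*) [CommRing S] (n : ℕ) : Prop :=
  Finite (IdealClasses S) ∧ Nat.card (IdealClasses S) = n

/-- The polynomial `x² - a x - b`. -/
noncomputable def quadPoly {R : Type*} [CommRing R] (a b : R) : R[X] :=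
  X ^ 2 - C a * X - C b

/-- The order `R[θ] = R[x]/(x² - a x - b)`. -/
abbrev QuadOrder {R : Type*} [CommRing R] (a b : R) : Type _ := AdjoinRoot (quadPoly a b)

/-- The root `θ` of `x² - a x - b` in `R[θ]`, the class of `x`. -/
noncomputable def quadRoot {R : Type*} [CommRing R] (a b : R) : QuadOrder a b :=
  AdjoinRoot.root (quadPoly a b)

/-- The set of integers `0 ≤ m ≤ v(a)` such that `v(b - r(r + a)) ≥ 2m` for some `r ∈ R`. -/
def levelSet {R : Type*} [CommRing R] [IsDomain R] [IsDiscreteValuationRing R] (a b : R) :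
    Set ℕ :=
  {m | (m : ℕ∞) ≤ IsDiscreteValuationRing.addVal R a ∧
    ∃ r : R, ((2 * m : ℕ) : ℕ∞) ≤ IsDiscreteValuationRing.addVal R (b - r * (r + a))}

/-- The set of integers `0 ≤ m ≤ e` such that `v(Δ - r²) ≥ 2m + v(Δ)` for some `r ∈ R`. -/
def squareLevelSet {R : Type*} [CommRing R] [IsDomain R] [IsDiscreteValuationRing R]
    (e : ℕ) (Δ : R) : Set ℕ :=
  {m | m ≤ e ∧ ∃ r : R, ((2 * m : ℕ) : ℕ∞) + IsDiscreteValuationRing.addVal R Δ ≤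
    IsDiscreteValuationRing.addVal R (Δ - r ^ 2)}

/-- The pair `(u, s)` satisfies `u² + s π^i = b` and `v(s) ≥ i`. -/
def IsSolutionAt {R : Type*} [CommRing R] [IsDomain R] [IsDiscreteValuationRing R]
    (π b : R) (i : ℕ) (u s : R) : Prop :=
  u ^ 2 + s * π ^ i = b ∧ (i : ℕ∞) ≤ IsDiscreteValuationRing.addVal R s

namespace QuadOrder

/-! ### Coordinates in the basis `1, θ`, and the ideals `R t ⊕ R (r + θ)` -/

section Basic

variable {R : Type*} [CommRing R] (a b : R)

/-! Every ideal class contains exactly one order between `R[θ]` and its fraction field, up to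
scaling; the theorem counts these orders.

If `(r + θ) / π ^ k` has trace and negated norm in `R`, that is `π ^ k ∣ 2r + a` and `π ^ (2k) ∣ b -
r(r + a)` (`IsOrderLevel`), then `R π ^ k ⊕ R (r + θ)` is `π ^ k` times the order generated by that
element. Every non-zero ideal is a multiple of some `R t ⊕ R (r + θ)` with `b - r(r + a) = t s`.
Multiplication by the conjugate of `r + θ` interchanges `t` and `s`, and one further shift of `r` by
`t` leads to such an order (`exists_idealEquiv_isOrderLevel`).

The level `k` determines the order, since `r` is unique modulo `π ^ k` (`IsOrderLevel.dvd_sub`). The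
class determines `k`, since equivalent ideals have the same multiplier ring
(`IsOrderLevel.le_of_idealEquiv`). So the ideal classes correspond to the levels that occur, and
these are closed downwards. The cases of the theorem solve the two divisibilities for `k`, after
completing the square when `2 ∣ a`. -/

theorem degree_linear_lt_two : (C a * X + C b).degree < ((2 : ℕ) : WithBot ℕ) :=
  lt_of_le_of_lt degree_linear_le (by norm_num)

theorem quadPoly_eq : quadPoly a b = X ^ 2 - (C a * X + C b) := by
  rw [quadPoly, sub_sub]

theorem quadPoly_monic : (quadPoly a b).Monic := by
  rw [quadPoly_eq]
  exact monic_X_pow_sub (degree_linear_lt_two a b)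

theorem degree_quadPoly [Nontrivial R] : (quadPoly a b).degree = 2 := by
  rw [quadPoly_eq, degree_sub_eq_left_of_degree_lt] <;> rw [degree_X_pow]
  · rfl
  · exact degree_linear_lt_two a b

theorem quadRoot_sq : quadRoot a b ^ 2 =
    algebraMap R (QuadOrder a b) a * quadRoot a b + algebraMap R (QuadOrder a b) b := by
  have h : AdjoinRoot.mk (quadPoly a b) (quadPoly a b) = 0 := AdjoinRoot.mk_self
  conv_lhs at h => arg 2; rw [quadPoly]
  simp only [map_sub, map_mul, map_pow, AdjoinRoot.mk_X, AdjoinRoot.mk_C] at h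
  rw [quadRoot, AdjoinRoot.algebraMap_eq]
  linear_combination h

variable {a b}

theorem exists_coord [Nontrivial R] (z : QuadOrder a b) : ∃ x y : R,
    z = algebraMap R (QuadOrder a b) x + algebraMap R (QuadOrder a b) y * quadRoot a b := by
  obtain ⟨p, rfl⟩ := AdjoinRoot.mk_surjective z
  have hlt := degree_modByMonic_lt p (quadPoly_monic a b)
  rw [degree_quadPoly] at hlt
  obtain ⟨y, x, hxy⟩ := exists_eq_X_add_C_of_natDegree_le_one
    (natDegree_le_of_degree_le (Order.le_of_lt_succ hlt))
  refine ⟨x, y, ?_⟩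
  have h : AdjoinRoot.mk (quadPoly a b) p = AdjoinRoot.mk (quadPoly a b) (p %ₘ quadPoly a b) := by
    rw [AdjoinRoot.mk_eq_mk]
    exact ⟨p /ₘ quadPoly a b, by rw [sub_eq_iff_eq_add', modByMonic_add_div]⟩
  rw [h, hxy, map_add, map_mul, AdjoinRoot.mk_C, AdjoinRoot.mk_C, AdjoinRoot.mk_X, quadRoot,
    AdjoinRoot.algebraMap_eq, add_comm]

theorem coord_eq_zero [Nontrivial R] {x y : R}
    (h : algebraMap R (QuadOrder a b) x + algebraMap R (QuadOrder a b) y * quadRoot a b = 0) :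
    x = 0 ∧ y = 0 := by
  have h' : AdjoinRoot.mk (quadPoly a b) (C y * X + C x) = 0 := by
    rw [map_add, map_mul, AdjoinRoot.mk_C, AdjoinRoot.mk_C, AdjoinRoot.mk_X, add_comm]
    exact h
  rw [AdjoinRoot.mk_eq_zero] at h'
  have h0 : C y * X + C x = 0 := by
    by_contra hne
    refine (quadPoly_monic a b).not_dvd_of_degree_lt hne ?_ h'
    rw [degree_quadPoly]
    exact degree_linear_lt_two y x
  exact ⟨by simpa using congrArg (fun p => coeff p 0) h0,
    by simpa using congrArg (fun p => coeff p 1) h0⟩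

theorem coord_inj [Nontrivial R] {x y x' y' : R}
    (h : algebraMap R (QuadOrder a b) x + algebraMap R (QuadOrder a b) y * quadRoot a b =
      algebraMap R (QuadOrder a b) x' + algebraMap R (QuadOrder a b) y' * quadRoot a b) :
    x = x' ∧ y = y' := by
  have := coord_eq_zero (a := a) (b := b) (x := x - x') (y := y - y') (by
    rw [map_sub, map_sub]; linear_combination h)
  exact ⟨sub_eq_zero.mp this.1, sub_eq_zero.mp this.2⟩

theorem algebraMap_ne_zero [Nontrivial R] {t : R} (ht : t ≠ 0) :
    algebraMap R (QuadOrder a b) t ≠ 0 := fun h =>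
  ht (coord_eq_zero (a := a) (b := b) (x := t) (y := 0) (by rw [h, map_zero]; ring)).1

variable (a b) in
/-- The ideal of `R[θ]` generated by `t` and `r + θ`. -/
noncomputable def stdIdeal (t r : R) : Ideal (QuadOrder a b) :=
  Ideal.span {algebraMap R (QuadOrder a b) t, algebraMap R (QuadOrder a b) r + quadRoot a b}

theorem stdIdeal_ne_bot [Nontrivial R] {t : R} (ht : t ≠ 0) (r : R) : stdIdeal a b t r ≠ ⊥ := by
  intro h
  have : algebraMap R (QuadOrder a b) t ∈ stdIdeal a b t r := Ideal.subset_span (by simp)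
  rw [h, Ideal.mem_bot] at this
  exact algebraMap_ne_zero ht this

theorem mem_stdIdeal [Nontrivial R] {t r : R} (h : t ∣ b - r * (r + a)) {z : QuadOrder a b} :
    z ∈ stdIdeal a b t r ↔ ∃ x y : R, z = algebraMap R (QuadOrder a b) (x * t) +
      algebraMap R (QuadOrder a b) y * (algebraMap R (QuadOrder a b) r + quadRoot a b) := by
  rw [stdIdeal, Ideal.mem_span_pair]
  constructor
  · rintro ⟨A, B, rfl⟩
    obtain ⟨s, hs⟩ := h
    obtain ⟨A₀, A₁, rfl⟩ := exists_coord A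
    obtain ⟨B₀, B₁, rfl⟩ := exists_coord B
    have hs' := congrArg (algebraMap R (QuadOrder a b)) hs
    refine ⟨A₀ - A₁ * r + B₁ * s, A₁ * t + B₀ + B₁ * (r + a), ?_⟩
    have hθ := quadRoot_sq a b
    simp only [map_add, map_mul, map_sub] at hs' ⊢
    linear_combination (algebraMap R (QuadOrder a b) B₁) * hθ +
      (algebraMap R (QuadOrder a b) B₁) * hs'
  · rintro ⟨x, y, rfl⟩
    exact ⟨algebraMap R _ x, algebraMap R _ y, by rw [map_mul]⟩

theorem isDirectSum_stdIdeal [IsDomain R] {t r : R} (ht : t ≠ 0) (h : t ∣ b - r * (r + a)) :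
    IsDirectSum R (stdIdeal a b t r) (algebraMap R (QuadOrder a b) t)
      (algebraMap R (QuadOrder a b) r + quadRoot a b) := by
  constructor
  · ext z
    rw [SetLike.mem_coe, SetLike.mem_coe, mem_stdIdeal h, Submodule.mem_span_pair]
    simp only [Algebra.smul_def, map_mul, eq_comm]
  · rw [LinearIndependent.pair_iff]
    intro x y hxy
    rw [Algebra.smul_def, Algebra.smul_def] at hxy
    obtain ⟨h₁, h₂⟩ := coord_eq_zero (a := a) (b := b) (x := x * t + y * r) (y := y) (by
      rw [map_add, map_mul, map_mul]; linear_combination hxy)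
    rw [h₂, zero_mul, add_zero] at h₁
    exact ⟨(mul_eq_zero.mp h₁).resolve_right ht, h₂⟩

theorem stdIdeal_add_mul (t r d : R) : stdIdeal a b t (r + d * t) = stdIdeal a b t r := by
  rw [stdIdeal, stdIdeal, map_add, map_mul, add_right_comm, Ideal.span_pair_add_mul_left]

theorem stdIdeal_congr {t r r' : R} (h : t ∣ r' - r) : stdIdeal a b t r' = stdIdeal a b t r := by
  obtain ⟨d, hd⟩ := h
  rw [← stdIdeal_add_mul t r d]
  congr 1
  linear_combination hd

theorem stdIdeal_unit_mul (u : Rˣ) (t r : R) : stdIdeal a b (u * t) r = stdIdeal a b t r := by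
  rw [stdIdeal, stdIdeal, map_mul, Ideal.span_insert, Ideal.span_insert,
    Ideal.span_singleton_mul_left_unit (u.isUnit.map _)]

theorem span_singleton_mul_span_pair {S : Type*} [CommRing S] (x y z : S) :
    Ideal.span {x} * Ideal.span {y, z} = Ideal.span {x * y, x * z} := by
  rw [Ideal.span_mul_span', Set.singleton_mul, Set.image_pair]

theorem isDomain [IsDomain R] [UniqueFactorizationMonoid R] (hf : Irreducible (quadPoly a b)) :
    IsDomain (QuadOrder a b) :=
  AdjoinRoot.isDomain_of_prime hf.prime

theorem sub_mul_add_ne_zero [IsDomain R] (hf : Irreducible (quadPoly a b)) (r : R) :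
    b - r * (r + a) ≠ 0 := by
  intro h
  have hb : b = r * (r + a) := sub_eq_zero.mp h
  have : quadPoly a b = (X + C r) * (X - C (r + a)) := by
    rw [quadPoly, hb, C_mul, C_add]; ring
  rcases hf.isUnit_or_isUnit this with h | h
  · exact not_isUnit_X_add_C _ h
  · exact not_isUnit_X_sub_C _ h

theorem disc_ne_zero [IsDomain R] (hf : Irreducible (quadPoly a b)) {c : R} (hc : 2 * c = a) :
    c ^ 2 + b ≠ 0 := by
  have := sub_mul_add_ne_zero hf (-c)
  rwa [← hc, show b - -c * (-c + 2 * c) = c ^ 2 + b by ring] at this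

theorem quadRoot_sub_sq {c : R} (hc : 2 * c = a) :
    (quadRoot a b - algebraMap R (QuadOrder a b) c) ^ 2 =
      algebraMap R (QuadOrder a b) (c ^ 2 + b) := by
  have h := congrArg (algebraMap R (QuadOrder a b)) hc
  simp only [map_mul, map_add, map_pow, map_ofNat] at h ⊢
  linear_combination quadRoot_sq a b - quadRoot a b * h

theorem idealEquiv_of_span_mul_eq {S : Type*} [CommRing S] [IsDomain S] {I J : Ideal S} {x y : S}
    (hx : x ≠ 0) (hy : y ≠ 0) (h : Ideal.span {x} * I = Ideal.span {y} * J) : IdealEquiv I J :=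
  ⟨x, mem_nonZeroDivisors_of_ne_zero hx, y, mem_nonZeroDivisors_of_ne_zero hy, h⟩

theorem IdealEquiv.refl' {S : Type*} [CommRing S] (I : Ideal S) : IdealEquiv I I :=
  ⟨1, one_mem _, 1, one_mem _, rfl⟩

theorem IdealEquiv.symm' {S : Type*} [CommRing S] {I J : Ideal S} (h : IdealEquiv I J) :
    IdealEquiv J I := by
  obtain ⟨α, hα, β, hβ, h⟩ := h
  exact ⟨β, hβ, α, hα, h.symm⟩

theorem IdealEquiv.trans' {S : Type*} [CommRing S] {I J L : Ideal S} (h : IdealEquiv I J)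
    (h' : IdealEquiv J L) : IdealEquiv I L := by
  obtain ⟨α, hα, β, hβ, h⟩ := h
  obtain ⟨γ, hγ, δ, hδ, h'⟩ := h'
  refine ⟨γ * α, mul_mem hγ hα, β * δ, mul_mem hβ hδ, ?_⟩
  rw [← Ideal.span_singleton_mul_span_singleton, ← Ideal.span_singleton_mul_span_singleton,
    mul_assoc, h, mul_assoc, ← h', mul_left_comm]

/-- The ideals `R t ⊕ R (r + θ)` and `R s ⊕ R (r + θ')` are equivalent if `t s` is, up to sign, the
norm of `r + θ`; here `θ' = a - θ` is the conjugate of `θ`. -/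
theorem idealEquiv_conj [IsDomain R] [UniqueFactorizationMonoid R]
    (hf : Irreducible (quadPoly a b)) {t s r : R} (h : b - r * (r + a) = t * s) :
    IdealEquiv (stdIdeal a b t r) (stdIdeal a b s (-r - a)) := by
  have := isDomain hf
  have hts := h ▸ sub_mul_add_ne_zero hf r
  have h' := congrArg (algebraMap R (QuadOrder a b)) h
  simp only [map_add, map_mul, map_sub] at h'
  -- The factor `-r - a + θ` is minus the conjugate of `r + θ`, so its product with `r + θ` is `t
  -- s`; both sides are then `t` times the second ideal.
  refine idealEquiv_of_span_mul_eq
    (x := algebraMap R (QuadOrder a b) (-r - a) + quadRoot a b)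
    (y := algebraMap R (QuadOrder a b) t) ?_ (algebraMap_ne_zero (left_ne_zero_of_mul hts)) ?_
  · intro h0
    exact one_ne_zero (coord_eq_zero (a := a) (b := b) (x := -r - a) (y := 1) (by
      rw [map_one, one_mul, h0])).2
  · rw [stdIdeal, stdIdeal, span_singleton_mul_span_pair, span_singleton_mul_span_pair,
      Ideal.span_pair_comm]
    congr 2
    · simp only [map_sub, map_neg]
      linear_combination h' + quadRoot_sq a b
    · rw [mul_comm]

/-- Every non-zero ideal of `R[θ]` is equivalent to some `R t ⊕ R (r + θ)`. -/
theorem exists_idealEquiv_stdIdeal [IsDomain R] [IsPrincipalIdealRing R]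
    (hf : Irreducible (quadPoly a b)) {J : Ideal (QuadOrder a b)} (hJ : J ≠ ⊥) :
    ∃ t r : R, t ∣ b - r * (r + a) ∧ IdealEquiv J (stdIdeal a b t r) := by
  have := isDomain hf
  have hθ := quadRoot_sq a b
  -- `G` consists of the `θ`-coefficients of elements of `J`. Its generator `g` divides all
  -- coordinates of elements of `J` and is the factor to be removed.
  let G : Ideal R :=
    { carrier := {y | ∃ x : R, algebraMap R (QuadOrder a b) x +
        algebraMap R (QuadOrder a b) y * quadRoot a b ∈ J}
      zero_mem' := ⟨0, by simp⟩
      add_mem' := by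
        rintro y y' ⟨x, hx⟩ ⟨x', hx'⟩
        refine ⟨x + x', ?_⟩
        convert J.add_mem hx hx' using 1
        simp only [map_add]; ring
      smul_mem' := by
        rintro c y ⟨x, hx⟩
        refine ⟨c * x, ?_⟩
        convert J.mul_mem_left (algebraMap R _ c) hx using 1
        simp only [map_mul, smul_eq_mul]; ring }
  obtain ⟨g, hg⟩ := IsPrincipalIdealRing.principal G
  obtain ⟨l, hl⟩ := IsPrincipalIdealRing.principal (J.comap (algebraMap R (QuadOrder a b)))
  have hG : ∀ {x y : R}, algebraMap R (QuadOrder a b) x +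
      algebraMap R (QuadOrder a b) y * quadRoot a b ∈ J → g ∣ y := fun {x y} h => by
    have : y ∈ G := ⟨x, h⟩
    rw [hg] at this
    exact Ideal.mem_span_singleton.mp this
  have hL : ∀ {x : R}, algebraMap R (QuadOrder a b) x ∈ J ↔ l ∣ x := fun {x} => by
    rw [← Ideal.mem_comap, hl]
    exact Ideal.mem_span_singleton
  -- Multiplication by `θ` sends `x + yθ` to `by + (x + ay)θ`, so `x + ay` lies in `G`.
  have hmul : ∀ {x y : R}, algebraMap R (QuadOrder a b) x +
      algebraMap R (QuadOrder a b) y * quadRoot a b ∈ J → g ∣ x + a * y := fun {x y} h => by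
    refine hG (x := b * y) ?_
    convert J.mul_mem_left (quadRoot a b) h using 1
    simp only [map_mul, map_add]
    linear_combination (-(algebraMap R (QuadOrder a b) y)) * hθ
  have hg0 : g ≠ 0 := by
    rintro rfl
    refine hJ ((Submodule.eq_bot_iff _).mpr fun z hz => ?_)
    obtain ⟨x, y, rfl⟩ := exists_coord z
    have hy : y = 0 := zero_dvd_iff.mp (hG hz)
    have hx := zero_dvd_iff.mp (hmul hz)
    rw [hy, mul_zero, add_zero] at hx
    simp [hx, hy]
  obtain ⟨x₀, hx₀⟩ : g ∈ G := by rw [hg]; exact Ideal.mem_span_singleton_self g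
  obtain ⟨r, rfl⟩ : g ∣ x₀ := (dvd_add_left (dvd_mul_left g a)).mp (hmul hx₀)
  obtain ⟨t, rfl⟩ : g ∣ l := by
    refine hG (x := 0) ?_
    rw [map_zero, zero_add]
    exact J.mul_mem_right _ (hL.mpr dvd_rfl)
  have ht : t ∣ b - r * (r + a) := by
    refine (mul_dvd_mul_iff_left hg0).mp (hL.mp ?_)
    -- Multiplying `g(r + θ)` by minus the conjugate of `r + θ` puts `g(b - r(r + a))` in `J ∩ R`,
    -- which is generated by `g t`.
    convert J.mul_mem_left (algebraMap R (QuadOrder a b) (-r - a) + quadRoot a b) hx₀ using 1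
    simp only [map_mul, map_sub, map_add, map_neg]
    linear_combination (-(algebraMap R (QuadOrder a b) g)) * hθ
  refine ⟨t, r, ht, idealEquiv_of_span_mul_eq one_ne_zero (algebraMap_ne_zero hg0) ?_⟩
  rw [Ideal.span_singleton_one, Ideal.top_mul]
  apply le_antisymm
  · intro z hz
    rw [Ideal.mem_span_singleton_mul]
    obtain ⟨x, y, rfl⟩ := exists_coord z
    obtain ⟨y', rfl⟩ := hG hz
    obtain ⟨x', hx'⟩ : g * t ∣ x - y' * (g * r) := by
      refine hL.mp ?_
      convert J.sub_mem hz (J.mul_mem_left (algebraMap R _ y') hx₀) using 1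
      simp only [map_mul, map_sub]; ring
    refine ⟨_, (mem_stdIdeal ht).mpr ⟨x', y', rfl⟩, ?_⟩
    have := congrArg (algebraMap R (QuadOrder a b)) hx'
    simp only [map_mul, map_sub] at this ⊢
    linear_combination -this
  · rw [stdIdeal, span_singleton_mul_span_pair, Ideal.span_le]
    rintro _ (rfl | rfl)
    · rw [← map_mul]; exact hL.mpr dvd_rfl
    · rw [mul_add, ← map_mul]; exact hx₀

theorem hasClassNumber_of_areAllIdealClasses {R S : Type*} [CommRing R] [CommRing S] [Algebra R S]
    {ι : Type*} [Finite ι] {x y : ι → S} (h : AreAllIdealClasses R x y) {n : ℕ}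
    (hn : Nat.card ι = n) : HasClassNumber S n := by
  obtain ⟨J, -, hJ⟩ := h
  exact ⟨Finite.of_surjective _ hJ.2, by rw [← hn, Nat.card_congr (Equiv.ofBijective _ hJ)]⟩

end Basic

/-! ### Levels and multiplier rings -/

section Level

variable {R : Type*} [CommRing R] {π a b : R}

variable (π a b) in
/-- The element `(r + θ) / π ^ k` is integral over `R`: its trace and its norm lie in `R`. -/
def IsOrderLevel (k : ℕ) (r : R) : Prop :=
  π ^ k ∣ 2 * r + a ∧ π ^ (2 * k) ∣ b - r * (r + a)

theorem IsOrderLevel.mono {k l : ℕ} {r : R} (h : IsOrderLevel π a b k r) (hl : l ≤ k) :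
    IsOrderLevel π a b l r :=
  ⟨(pow_dvd_pow π hl).trans h.1, (pow_dvd_pow π (by lia)).trans h.2⟩

theorem IsOrderLevel.dvd {k : ℕ} {r : R} (h : IsOrderLevel π a b k r) :
    π ^ k ∣ b - r * (r + a) :=
  (pow_dvd_pow π (by lia)).trans h.2

theorem isOrderLevel_sub_iff {c : R} (hc : 2 * c = a) (k : ℕ) (d : R) :
    IsOrderLevel π a b k (d - c) ↔ π ^ k ∣ 2 * d ∧ π ^ (2 * k) ∣ c ^ 2 + b - d ^ 2 := by
  rw [IsOrderLevel, ← hc, show 2 * (d - c) + 2 * c = 2 * d by ring,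
    show b - (d - c) * (d - c + 2 * c) = c ^ 2 + b - d ^ 2 by ring]

/-- The element `ω = (r + θ) / π ^ k` satisfies `ω² = pω + q` with `p, q ∈ R`, so the ideal, being
`π ^ k (R ⊕ Rω)`, is stable under `ω`. The witness is `ω(x + yω) = yq + (x + yp)ω`. -/
theorem IsOrderLevel.mul_mem [Nontrivial R] {k : ℕ} {r : R} (h : IsOrderLevel π a b k r)
    {z : QuadOrder a b} (hz : z ∈ stdIdeal a b (π ^ k) r) :
    (algebraMap R (QuadOrder a b) r + quadRoot a b) * z ∈
      Ideal.span {algebraMap R (QuadOrder a b) (π ^ k)} * stdIdeal a b (π ^ k) r := by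
  obtain ⟨x, y, rfl⟩ := (mem_stdIdeal h.dvd).mp hz
  obtain ⟨⟨p, hp⟩, ⟨q, hq⟩⟩ := h
  rw [two_mul, pow_add] at hq
  have hq' := congrArg (algebraMap R (QuadOrder a b)) hq
  have hp' := congrArg (algebraMap R (QuadOrder a b)) hp
  have hd : π ^ k ∣ b - r * (r + a) := ⟨π ^ k * q, by rw [hq, mul_assoc]⟩
  rw [Ideal.mem_span_singleton_mul]
  refine ⟨_, (mem_stdIdeal hd).mpr ⟨y * q, x + y * p, rfl⟩, ?_⟩
  simp only [map_mul, map_add, map_sub, map_ofNat] at hp' hq' ⊢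
  linear_combination (-(algebraMap R (QuadOrder a b) y)) * (quadRoot_sq a b) -
    (algebraMap R (QuadOrder a b) y) * hq' -
    (algebraMap R (QuadOrder a b) y) * (algebraMap R (QuadOrder a b) r + quadRoot a b) * hp'

/-- For `y ≠ 0` the inclusion means that `x / y` lies in the multiplier ring of the ideal, an
invariant of the class. -/
theorem mul_le_of_idealEquiv {S : Type*} [CommRing S] [IsDomain S] {I J : Ideal S}
    (h : IdealEquiv I J) {x y : S} (hI : Ideal.span {x} * I ≤ Ideal.span {y} * I) :
    Ideal.span {x} * J ≤ Ideal.span {y} * J := by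
  obtain ⟨α, -, β, hβ, h⟩ := h
  have hβ0 : β ≠ 0 := nonZeroDivisors.ne_zero hβ
  have h' : Ideal.span {β} * (Ideal.span {x} * J) ≤ Ideal.span {β} * (Ideal.span {y} * J) := by
    rw [mul_left_comm, ← h, mul_left_comm (Ideal.span {β}), ← h, mul_left_comm,
      mul_left_comm (Ideal.span {y})]
    exact Ideal.mul_mono_right hI
  rwa [Ideal.span_singleton_mul_right_mono hβ0] at h'

theorem IsOrderLevel.le_of_idealEquiv [IsDomain R] [UniqueFactorizationMonoid R]
    (hf : Irreducible (quadPoly a b)) (hπ : Irreducible π) {k l : ℕ} {r r' : R}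
    (h : IsOrderLevel π a b k r) (h' : π ^ l ∣ b - r' * (r' + a))
    (he : IdealEquiv (stdIdeal a b (π ^ k) r) (stdIdeal a b (π ^ l) r')) : k ≤ l := by
  have := isDomain hf
  have key := mul_le_of_idealEquiv he
    (x := algebraMap R (QuadOrder a b) r + quadRoot a b)
    (y := algebraMap R (QuadOrder a b) (π ^ k)) (by
      intro z hz
      obtain ⟨w, hw, rfl⟩ := Ideal.mem_span_singleton_mul.mp hz
      exact h.mul_mem hw)
  -- Since `(r + θ) / π ^ k` stabilises the second ideal, it sends `π ^ l` into it; the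
  -- `θ`-coefficient then gives `π ^ k ∣ π ^ l`.
  have hmem := key (Ideal.mul_mem_mul (Ideal.mem_span_singleton_self _)
    ((mem_stdIdeal h').mpr ⟨1, 0, rfl⟩))
  obtain ⟨w, hw, hw'⟩ := Ideal.mem_span_singleton_mul.mp hmem
  obtain ⟨x, y, rfl⟩ := (mem_stdIdeal h').mp hw
  have := (coord_inj (a := a) (b := b) (x := π ^ k * (x * π ^ l + y * r')) (y := π ^ k * y)
    (x' := r * π ^ l) (y' := π ^ l) (by
      simp only [map_zero, one_mul, zero_mul, add_zero] at hw'
      simp only [map_mul, map_add] at hw' ⊢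
      linear_combination hw')).2
  exact (pow_dvd_pow_iff hπ.ne_zero hπ.not_isUnit).mp ⟨y, this.symm⟩

end Level

/-! ### Reduction of every ideal to a level -/

section DVR

open IsDiscreteValuationRing

variable {R : Type*} [CommRing R] [IsDomain R] [IsDiscreteValuationRing R] {π a b : R}

theorem le_addVal_iff (hπ : Irreducible π) {n : ℕ} {x : R} :
    (n : ℕ∞) ≤ addVal R x ↔ π ^ n ∣ x := by
  rw [← addVal_le_iff_dvd, hπ.addVal_pow]

theorem exists_addVal_eq {x : R} (hx : x ≠ 0) : ∃ n : ℕ, addVal R x = n :=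
  ⟨_, (ENat.natCast_toNat (mt addVal_eq_top_iff.mp hx)).symm⟩

theorem exists_eq_unit_mul_of_addVal_eq (hπ : Irreducible π) {x : R} {n : ℕ}
    (hx : addVal R x = n) : ∃ u : Rˣ, x = u * π ^ n := by
  have := (addVal_eq_iff_associated x (π ^ n)).mp (by rw [hx, hπ.addVal_pow])
  obtain ⟨u, hu⟩ := this.symm
  exact ⟨u, by rw [← hu, mul_comm]⟩

/-- The two norm conditions subtract to `π ^ (2k) ∣ (r' - r)(r' + r + a)`. If `v(r' - r) < k`, the
trace condition gives both factors the same valuation, a contradiction. -/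
theorem IsOrderLevel.dvd_sub (hπ : Irreducible π) {k : ℕ} {r r' : R}
    (h : IsOrderLevel π a b k r) (h' : IsOrderLevel π a b k r') : π ^ k ∣ r' - r := by
  by_contra hd
  have hd0 : r' - r ≠ 0 := fun h0 => hd (h0 ▸ dvd_zero _)
  obtain ⟨n, hn⟩ := exists_addVal_eq hd0
  rw [← le_addVal_iff hπ, hn, not_le, Nat.cast_lt] at hd
  have h1 : addVal R ((r' - r) + (2 * r + a)) = n := by
    rw [AddValuation.map_add_eq_of_lt_left _ (lt_of_lt_of_le (b := (k : ℕ∞)) _ _), hn]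
    · rw [hn]; exact_mod_cast hd
    · exact (le_addVal_iff hπ).mpr h.1
  have h2 : π ^ (2 * k) ∣ (r' - r) * ((r' - r) + (2 * r + a)) := by
    convert _root_.dvd_sub h.2 h'.2 using 1
    ring
  rw [← le_addVal_iff hπ, addVal_mul, h1, hn] at h2
  norm_cast at h2
  lia

/-- Every non-zero ideal is equivalent to `π ^ k` times an order containing `R[θ]`. -/
theorem exists_idealEquiv_isOrderLevel (hπ : Irreducible π) (hf : Irreducible (quadPoly a b))
    {J : Ideal (QuadOrder a b)} (hJ : J ≠ ⊥) :
    ∃ k r, IsOrderLevel π a b k r ∧ IdealEquiv J (stdIdeal a b (π ^ k) r) := by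
  obtain ⟨t₀, r₀, ht₀, hJ₀⟩ := exists_idealEquiv_stdIdeal hf hJ
  obtain ⟨t, s, r, hts, hv, hJr⟩ : ∃ t s r : R, b - r * (r + a) = t * s ∧
      addVal R t ≤ addVal R s ∧ IdealEquiv J (stdIdeal a b t r) := by
    obtain ⟨s₀, hs₀⟩ := ht₀
    rcases le_total (addVal R t₀) (addVal R s₀) with h | h
    · exact ⟨t₀, s₀, r₀, hs₀, h, hJ₀⟩
    · refine ⟨s₀, t₀, -r₀ - a, ?_, h, IdealEquiv.trans' hJ₀ (idealEquiv_conj hf hs₀)⟩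
      linear_combination hs₀
  have hts0 := hts ▸ sub_mul_add_ne_zero hf r
  obtain ⟨k, hk⟩ := exists_addVal_eq (left_ne_zero_of_mul hts0)
  by_cases htr : π ^ k ∣ 2 * r + a
  · obtain ⟨u, rfl⟩ := exists_eq_unit_mul_of_addVal_eq hπ hk
    rw [stdIdeal_unit_mul] at hJr
    refine ⟨k, r, ⟨htr, ?_⟩, hJr⟩
    rw [← le_addVal_iff hπ, hts, addVal_mul, hk, two_mul, Nat.cast_add]
    rw [hk] at hv
    gcongr
  -- The trace has valuation `g < k`. Replacing `r` by `r + t` keeps the ideal but makes the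
  -- cofactor `s - t - (2r + a)`, of valuation exactly `g`; conjugation then gives level `g`, since
  -- the norm has valuation `k + g ≥ 2g`.
  · obtain ⟨g, hg⟩ := exists_addVal_eq (x := 2 * r + a) (fun h0 => htr (h0 ▸ dvd_zero _))
    rw [← le_addVal_iff hπ, hg, not_le, Nat.cast_lt] at htr
    have hw : addVal R (s - t - (2 * r + a)) = g := by
      rw [AddValuation.map_sub_eq_of_lt_right, hg]
      refine lt_of_lt_of_le (b := (k : ℕ∞)) (by rw [hg]; exact_mod_cast htr) ?_
      exact AddValuation.map_le_sub _ (hk ▸ hv) hk.ge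
    obtain ⟨u, hu⟩ := exists_eq_unit_mul_of_addVal_eq hπ hw
    have hnorm : b - (r + t) * (r + t + a) = t * (s - t - (2 * r + a)) := by
      linear_combination hts
    have he : IdealEquiv J (stdIdeal a b (π ^ g) (-(r + t) - a)) := by
      have h1 := idealEquiv_conj hf hnorm
      rw [hu, stdIdeal_unit_mul, stdIdeal_congr (t := t) (r := r) (by simp)] at h1
      exact IdealEquiv.trans' hJr h1
    refine ⟨g, _, ⟨?_, ?_⟩, he⟩
    · have h1 : π ^ g ∣ 2 * r + a := (le_addVal_iff hπ).mp hg.ge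
      have h2 : π ^ g ∣ t := (le_addVal_iff hπ).mp (by rw [hk]; exact_mod_cast htr.le)
      have : 2 * (-(r + t) - a) + a = -(2 * r + a + 2 * t) := by ring
      rw [this, dvd_neg]
      exact dvd_add h1 (h2.mul_left 2)
    · have : b - (-(r + t) - a) * (-(r + t) - a + a) = t * (s - t - (2 * r + a)) := by
        linear_combination hnorm
      rw [← le_addVal_iff hπ, this, addVal_mul, hw, hk]
      norm_cast
      lia

/-- If the ideals `R t_i ⊕ R (r_i + θ)` are equivalent to multiples of pairwise different orders,
and if every order occurs, then they represent all ideal classes. -/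
theorem areAllIdealClasses_of_idealEquiv (hπ : Irreducible π) (hf : Irreducible (quadPoly a b))
    {ι : Type*} (k : ι → ℕ) (r t ρ : ι → R) (hk : Function.Injective k)
    (hkr : ∀ i, IsOrderLevel π a b (k i) (r i))
    (hall : ∀ l s, IsOrderLevel π a b l s → ∃ i, k i = l)
    (ht : ∀ i, t i ∣ b - ρ i * (ρ i + a))
    (he : ∀ i, IdealEquiv (stdIdeal a b (t i) (ρ i)) (stdIdeal a b (π ^ k i) (r i))) :
    AreAllIdealClasses R (fun i => algebraMap R (QuadOrder a b) (t i))
      (fun i => algebraMap R (QuadOrder a b) (ρ i) + quadRoot a b) := by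
  have ht0 : ∀ i, t i ≠ 0 := fun i h0 =>
    sub_mul_add_ne_zero hf (ρ i) (zero_dvd_iff.mp (h0 ▸ ht i))
  refine ⟨fun i => ⟨stdIdeal a b (t i) (ρ i), stdIdeal_ne_bot (ht0 i) _⟩,
    fun i => isDirectSum_stdIdeal (ht0 i) (ht i), fun i j hij => hk ?_, fun c => ?_⟩
  · have hij' : IdealEquiv (stdIdeal a b (t i) (ρ i)) (stdIdeal a b (t j) (ρ j)) :=
      Quotient.exact hij
    have h := IdealEquiv.trans' (IdealEquiv.symm' (he i)) (IdealEquiv.trans' hij' (he j))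
    exact le_antisymm ((hkr i).le_of_idealEquiv hf hπ (hkr j).dvd h)
      ((hkr j).le_of_idealEquiv hf hπ (hkr i).dvd (IdealEquiv.symm' h))
  · obtain ⟨⟨J, hJ⟩, rfl⟩ := Quotient.exists_rep c
    obtain ⟨l, s, hls, hJs⟩ := exists_idealEquiv_isOrderLevel hπ hf hJ
    obtain ⟨i, rfl⟩ := hall l s hls
    refine ⟨i, Quotient.sound ?_⟩
    change IdealEquiv (stdIdeal a b (t i) (ρ i)) J
    -- At a given level there is only one ideal, whichever `r` is used.
    rw [stdIdeal_congr ((hkr i).dvd_sub hπ hls)] at hJs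
    exact IdealEquiv.trans' (he i) (IdealEquiv.symm' hJs)

/-! ### Determination of the levels that occur -/

theorem areAllIdealClasses (hπ : Irreducible π) (hf : Irreducible (quadPoly a b))
    {ι : Type*} (k : ι → ℕ) (r : ι → R) (hk : Function.Injective k)
    (hkr : ∀ i, IsOrderLevel π a b (k i) (r i))
    (hall : ∀ l s, IsOrderLevel π a b l s → ∃ i, k i = l) :
    AreAllIdealClasses R (fun i => algebraMap R (QuadOrder a b) (π ^ k i))
      (fun i => algebraMap R (QuadOrder a b) (r i) + quadRoot a b) :=
  areAllIdealClasses_of_idealEquiv hπ hf k r _ r hk hkr hall (fun i => (hkr i).dvd)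
    fun _ => IdealEquiv.refl' _

theorem areAllIdealClasses_fin (hπ : Irreducible π) (hf : Irreducible (quadPoly a b))
    {m : ℕ} {r : R} (hr : IsOrderLevel π a b m r)
    (hall : ∀ l s, IsOrderLevel π a b l s → l ≤ m) :
    AreAllIdealClasses R (fun k : Fin (m + 1) => algebraMap R (QuadOrder a b) (π ^ (k : ℕ)))
      (fun _ => algebraMap R (QuadOrder a b) r + quadRoot a b) :=
  areAllIdealClasses hπ hf (fun k : Fin (m + 1) => (k : ℕ)) (fun _ => r) Fin.val_injective
    (fun k => hr.mono (Nat.lt_succ_iff.mp k.2))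
    fun l s h => ⟨⟨l, Nat.lt_succ_iff.mpr (hall l s h)⟩, rfl⟩

/-- By `hv` the trace condition becomes `k ≤ v(a)`, independently of `r`. This covers both `v(a) <
v(2)` and characteristic two with `a ≠ 0`. -/
theorem areAllIdealClasses_levelSet (hπ : Irreducible π) (hf : Irreducible (quadPoly a b))
    (ha : a ≠ 0) (hv : ∀ r, addVal R (2 * r + a) = addVal R a) :
    ∃ m : ℕ, IsGreatest (levelSet a b) m ∧
      (∀ r : R, ((2 * m : ℕ) : ℕ∞) ≤ addVal R (b - r * (r + a)) →
        AreAllIdealClasses R (fun k : Fin (m + 1) => algebraMap R (QuadOrder a b) (π ^ (k : ℕ)))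
          (fun _ => algebraMap R (QuadOrder a b) r + quadRoot a b)) ∧
      HasClassNumber (QuadOrder a b) (m + 1) := by
  have hiff : ∀ k r, IsOrderLevel π a b k r ↔
      (k : ℕ∞) ≤ addVal R a ∧ ((2 * k : ℕ) : ℕ∞) ≤ addVal R (b - r * (r + a)) := fun k r => by
    rw [IsOrderLevel, ← le_addVal_iff hπ, ← le_addVal_iff hπ, hv]
  obtain ⟨n, hn⟩ := exists_addVal_eq ha
  have hbdd : BddAbove (levelSet a b) := ⟨n, fun k hk => by
    have := hk.1
    rw [hn] at this
    exact_mod_cast this⟩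
  have hne : (levelSet a b).Nonempty := ⟨0, by simp, 0, by simp⟩
  have hgr : IsGreatest (levelSet a b) (sSup (levelSet a b)) :=
    ⟨Nat.sSup_mem hne hbdd, fun k hk => le_csSup hbdd hk⟩
  generalize sSup (levelSet a b) = m at hgr
  have hall : ∀ r : R, ((2 * m : ℕ) : ℕ∞) ≤ addVal R (b - r * (r + a)) →
      AreAllIdealClasses R (fun k : Fin (m + 1) => algebraMap R (QuadOrder a b) (π ^ (k : ℕ)))
        (fun _ => algebraMap R (QuadOrder a b) r + quadRoot a b) := fun r hr =>
    areAllIdealClasses_fin hπ hf ((hiff m r).mpr ⟨hgr.1.1, hr⟩) fun l s hls =>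
      hgr.2 ⟨((hiff l s).mp hls).1, s, ((hiff l s).mp hls).2⟩
  obtain ⟨r, hr⟩ := hgr.1.2
  exact ⟨m, hgr, hall, hasClassNumber_of_areAllIdealClasses (hall r hr) (by simp)⟩

/-- The element `θ - c` has trace zero and square `c ^ 2 + b`, so only the norm condition is left.
-/
theorem isOrderLevel_neg {c : R} (hπ : Irreducible π) (hc : 2 * c = a) {N k : ℕ}
    (hN : addVal R (c ^ 2 + b) = N) (hk : k ≤ N / 2) : IsOrderLevel π a b k (-c) := by
  rw [← zero_sub, isOrderLevel_sub_iff hc, mul_zero, ← le_addVal_iff hπ (n := 2 * k)]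
  refine ⟨dvd_zero _, ?_⟩
  rw [zero_pow two_ne_zero, sub_zero, hN]
  exact_mod_cast (by lia : 2 * k ≤ N)

theorem areAllIdealClasses_half (hπ : Irreducible π) (hf : Irreducible (quadPoly a b)) {c : R}
    (hc : 2 * c = a) {N : ℕ} (hN : addVal R (c ^ 2 + b) = N)
    (hle : ∀ k d, π ^ k ∣ 2 * d → π ^ (2 * k) ∣ c ^ 2 + b - d ^ 2 → k ≤ N / 2) :
    AreAllIdealClasses R
        (fun k : Fin (N / 2 + 1) => algebraMap R (QuadOrder a b) (π ^ (k : ℕ)))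
        (fun _ => quadRoot a b - algebraMap R (QuadOrder a b) c) ∧
      HasClassNumber (QuadOrder a b) (N / 2 + 1) := by
  have h := areAllIdealClasses_fin hπ hf (isOrderLevel_neg hπ hc hN le_rfl) fun l s hls => by
    rw [← add_sub_cancel_right s c, isOrderLevel_sub_iff hc] at hls
    exact hle l _ hls.1 hls.2
  simp only [map_neg, neg_add_eq_sub] at h
  exact ⟨h, hasClassNumber_of_areAllIdealClasses h (by simp)⟩

/-- If `x - d²` is more divisible than `x`, then `v(x) = 2 v(d)`. -/
theorem addVal_sq_eq {x d : R} {n N : ℕ} (hπ : Irreducible π) (hN : addVal R x = N) (hn : N < n)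
    (h : π ^ n ∣ x - d ^ 2) : ∃ j : ℕ, addVal R d = j ∧ N = 2 * j := by
  have hd2 : addVal R (d ^ 2) = N := by
    rw [← hN, show d ^ 2 = x - (x - d ^ 2) by ring, AddValuation.map_sub_eq_of_lt_left]
    refine lt_of_lt_of_le (b := (n : ℕ∞)) (by rw [hN]; exact_mod_cast hn) ?_
    exact (le_addVal_iff hπ).mpr h
  have hd0 : d ≠ 0 := by
    rintro rfl
    simp at hd2
  obtain ⟨j, hj⟩ := exists_addVal_eq hd0
  rw [addVal_pow, hj, nsmul_eq_mul] at hd2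
  exact ⟨j, hj, by exact_mod_cast hd2.symm⟩

theorem areAllIdealClasses_isUnit_two (hπ : Irreducible π) (hf : Irreducible (quadPoly a b))
    (h2 : IsUnit (2 : R)) : ∃ c : R, 2 * c = a ∧ ∃ N : ℕ, addVal R (c ^ 2 + b) = N ∧
      AreAllIdealClasses R
        (fun k : Fin (N / 2 + 1) => algebraMap R (QuadOrder a b) (π ^ (k : ℕ)))
        (fun _ => quadRoot a b - algebraMap R (QuadOrder a b) c) ∧
      HasClassNumber (QuadOrder a b) (N / 2 + 1) := by
  obtain ⟨c, hc⟩ := h2.dvd (a := a)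
  obtain ⟨N, hN⟩ := exists_addVal_eq (disc_ne_zero hf hc.symm)
  refine ⟨c, hc.symm, N, hN, areAllIdealClasses_half hπ hf hc.symm hN fun k d h h' => ?_⟩
  rw [h2.dvd_mul_left] at h
  have hd : π ^ (2 * k) ∣ d ^ 2 := by
    rw [mul_comm, pow_mul]
    exact pow_dvd_pow_of_dvd h 2
  have := (dvd_sub_left hd).mp h'
  rw [← le_addVal_iff hπ, hN, Nat.cast_le] at this
  lia

theorem areAllIdealClasses_odd (hπ : Irreducible π) (hf : Irreducible (quadPoly a b)) {c : R}
    (hc : 2 * c = a) {N : ℕ} (hN : addVal R (c ^ 2 + b) = N) (hodd : Odd N) :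
    AreAllIdealClasses R
        (fun k : Fin (N / 2 + 1) => algebraMap R (QuadOrder a b) (π ^ (k : ℕ)))
        (fun _ => quadRoot a b - algebraMap R (QuadOrder a b) c) ∧
      HasClassNumber (QuadOrder a b) (N / 2 + 1) := by
  refine areAllIdealClasses_half hπ hf hc hN fun k d _ h' => ?_
  by_contra hk
  -- A level above `N / 2` would make `N` the valuation of a square.
  obtain ⟨j, -, hj⟩ := addVal_sq_eq hπ hN (by lia) h'
  obtain ⟨i, hi⟩ := hodd
  lia

theorem areAllIdealClasses_even (hπ : Irreducible π) (hf : Irreducible (quadPoly a b)) {c : R}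
    (hc : 2 * c = a) {N e : ℕ} (hN : addVal R (c ^ 2 + b) = N) (heven : Even N)
    (he : addVal R 2 = e) :
    ∃ m : ℕ, IsGreatest (squareLevelSet e (c ^ 2 + b)) m ∧
      (∀ r : R, ((2 * m : ℕ) : ℕ∞) + addVal R (c ^ 2 + b) ≤ addVal R (c ^ 2 + b - r ^ 2) →
        AreAllIdealClasses R
          (Sum.elim (fun k : Fin (N / 2 + 1) => algebraMap R (QuadOrder a b) (π ^ (k : ℕ)))
            (fun i : Fin m => algebraMap R (QuadOrder a b) (π ^ (N / 2 + ((i : ℕ) + 1)))))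
          (Sum.elim (fun _ => quadRoot a b - algebraMap R (QuadOrder a b) c)
            (fun _ => algebraMap R (QuadOrder a b) r + quadRoot a b -
              algebraMap R (QuadOrder a b) c))) ∧
      HasClassNumber (QuadOrder a b) (N / 2 + m + 1) := by
  have hN2 : 2 * (N / 2) = N := Nat.two_mul_div_two_of_even heven
  have hbdd : BddAbove (squareLevelSet e (c ^ 2 + b)) := ⟨e, fun k hk => hk.1⟩
  have hne : (squareLevelSet e (c ^ 2 + b)).Nonempty := ⟨0, Nat.zero_le _, 0, by simp⟩
  have hgr : IsGreatest (squareLevelSet e (c ^ 2 + b)) (sSup (squareLevelSet e (c ^ 2 + b))) :=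
    ⟨Nat.sSup_mem hne hbdd, fun k hk => le_csSup hbdd hk⟩
  generalize sSup (squareLevelSet e (c ^ 2 + b)) = m at hgr
  have hdvd : ∀ {i d}, ((2 * i : ℕ) : ℕ∞) + addVal R (c ^ 2 + b) ≤ addVal R (c ^ 2 + b - d ^ 2) ↔
      π ^ (2 * (N / 2 + i)) ∣ c ^ 2 + b - d ^ 2 := fun {i d} => by
    rw [hN, ← Nat.cast_add, le_addVal_iff hπ, show 2 * i + N = 2 * (N / 2 + i) by lia]
  -- For `i > 0` the norm condition forces `v(d) = N / 2`, so the trace condition reads `N / 2 + i ≤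
  -- e + N / 2`.
  have htwo : ∀ {i d}, 0 < i → π ^ (2 * (N / 2 + i)) ∣ c ^ 2 + b - d ^ 2 →
      (π ^ (N / 2 + i) ∣ 2 * d ↔ i ≤ e) := fun {i d} hi hd => by
    obtain ⟨j, hj, hNj⟩ := addVal_sq_eq hπ hN (by lia) hd
    rw [← le_addVal_iff hπ, addVal_mul, he, hj]
    norm_cast
    lia
  have hall : ∀ r : R, ((2 * m : ℕ) : ℕ∞) + addVal R (c ^ 2 + b) ≤ addVal R (c ^ 2 + b - r ^ 2) →
      AreAllIdealClasses R
        (Sum.elim (fun k : Fin (N / 2 + 1) => algebraMap R (QuadOrder a b) (π ^ (k : ℕ)))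
          (fun i : Fin m => algebraMap R (QuadOrder a b) (π ^ (N / 2 + ((i : ℕ) + 1)))))
        (Sum.elim (fun _ => quadRoot a b - algebraMap R (QuadOrder a b) c)
          (fun _ => algebraMap R (QuadOrder a b) r + quadRoot a b -
            algebraMap R (QuadOrder a b) c)) := by
    intro r hr
    have h := areAllIdealClasses (ι := Fin (N / 2 + 1) ⊕ Fin m) hπ hf
      (Sum.elim (fun k => (k : ℕ)) (fun i => N / 2 + ((i : ℕ) + 1)))
      (Sum.elim (fun _ => -c) (fun _ => r - c)) ?_ ?_ ?_
    · convert h using 1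
      · funext i
        rcases i with i | i <;> rfl
      · funext i
        rcases i with i | i
        · simp [neg_add_eq_sub]
        · simp only [Sum.elim_inr, map_sub]
          ring
    · rintro (i | i) (j | j) hij <;> simp only [Sum.elim_inl, Sum.elim_inr] at hij
      · rw [Fin.ext hij]
      · lia
      · lia
      · rw [Fin.ext (show (i : ℕ) = j by lia)]
    · rintro (i | i)
      · exact isOrderLevel_neg hπ hc hN (Nat.lt_succ_iff.mp i.2)
      -- `htwo` needs a positive index. If `m = 0`, this family is empty and nothing is required of
      -- `r`.
      · have hm : 0 < m := i.pos
        have hr' := hdvd.mp hr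
        have hlev : IsOrderLevel π a b (N / 2 + m) (r - c) :=
          (isOrderLevel_sub_iff hc _ _).mpr ⟨(htwo hm hr').mpr hgr.1.1, hr'⟩
        exact hlev.mono (by simp only [Sum.elim_inr]; lia)
    · intro l s hls
      rw [← add_sub_cancel_right s c, isOrderLevel_sub_iff hc] at hls
      by_cases hl : l ≤ N / 2
      · exact ⟨Sum.inl ⟨l, Nat.lt_succ_iff.mpr hl⟩, rfl⟩
      · obtain ⟨i, rfl⟩ := Nat.exists_eq_add_of_lt (not_le.mp hl)
        have hi : i + 1 ≤ m :=
          hgr.2 ⟨(htwo i.succ_pos hls.2).mp hls.1, s + c, hdvd.mpr hls.2⟩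
        exact ⟨Sum.inr ⟨i, hi⟩, rfl⟩
  obtain ⟨r, hr⟩ := hgr.1.2
  refine ⟨m, hgr, hall, hasClassNumber_of_areAllIdealClasses (hall r hr) ?_⟩
  rw [Nat.card_sum, Nat.card_fin, Nat.card_fin]
  lia

/-! ### Characteristic two -/

theorem separable_map_iff {K : Type*} [Field K] [Algebra R K] [IsFractionRing R K]
    (h2 : (2 : R) = 0) : ((quadPoly a b).map (algebraMap R K)).Separable ↔ a ≠ 0 := by
  have h2K : (2 : K) = 0 := by rw [← map_ofNat (algebraMap R K) 2, h2, map_zero]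
  have hder : derivative ((quadPoly a b).map (algebraMap R K)) = C (-algebraMap R K a) := by
    simp [quadPoly, one_add_one_eq_two, h2K]
  rw [separable_def, hder]
  constructor
  · rintro h rfl
    rw [map_zero, neg_zero, C_0, isCoprime_zero_right] at h
    refine not_isUnit_of_degree_pos _ ?_ h
    rw [(quadPoly_monic 0 b).degree_map, degree_quadPoly]
    norm_num
  · intro ha
    have : IsUnit (C (-algebraMap R K a)) := by
      rw [isUnit_C, isUnit_iff_ne_zero, neg_ne_zero]
      exact (map_ne_zero_iff _ (IsFractionRing.injective R K)).mpr ha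
    obtain ⟨u, hu⟩ := this
    exact ⟨0, ↑u⁻¹, by rw [← hu, zero_mul, zero_add, Units.inv_mul]⟩

theorem isOrderLevel_iff_exists_isSolutionAt (hπ : Irreducible π) (h2 : (2 : R) = 0) {k : ℕ}
    {u : R} : IsOrderLevel π 0 b k u ↔ ∃ s, IsSolutionAt π b k u s := by
  rw [IsOrderLevel, h2, zero_mul, add_zero, add_zero]
  constructor
  · rintro ⟨-, q, hq⟩
    refine ⟨π ^ k * q, by linear_combination -hq, (le_addVal_iff hπ).mpr (dvd_mul_right _ _)⟩
  · rintro ⟨s, hs, hv⟩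
    refine ⟨dvd_zero _, ?_⟩
    rw [← hs, show u ^ 2 + s * π ^ k - u * u = s * π ^ k by ring, two_mul, pow_add]
    exact mul_dvd_mul_right ((le_addVal_iff hπ).mp hv) _

theorem areAllIdealClasses_inseparable (hπ : Irreducible π) (hf : Irreducible (quadPoly 0 b))
    (h2 : (2 : R) = 0) (u s : ℕ → R)
    (hus : ∀ i, (∃ u' s', IsSolutionAt π b i u' s') → IsSolutionAt π b i (u i) (s i)) :
    AreAllIdealClasses R
      (fun i : {i : ℕ // ∃ u' s', IsSolutionAt π b i u' s'} =>
        algebraMap R (QuadOrder 0 b) (s i))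
      (fun i => algebraMap R (QuadOrder 0 b) (u i) + quadRoot 0 b) := by
  have hnorm : ∀ i : {i : ℕ // ∃ u' s', IsSolutionAt π b i u' s'},
      b - u i * (u i + 0) = s i * π ^ (i : ℕ) := fun i => by
    linear_combination -(hus i i.2).1
  refine areAllIdealClasses_of_idealEquiv (ι := {i : ℕ // ∃ u' s', IsSolutionAt π b i u' s'})
    hπ hf (fun i => i.1) (fun i => u i.1) (fun i => s i.1) (fun i => u i.1) ?_ ?_ ?_ ?_ fun i => ?_
  · exact Subtype.val_injective
  · exact fun i => (isOrderLevel_iff_exists_isSolutionAt hπ h2).mpr ⟨_, hus i i.2⟩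
  · exact fun l r hlr => ⟨⟨l, r, (isOrderLevel_iff_exists_isSolutionAt hπ h2).mp hlr⟩, rfl⟩
  · exact fun i => ⟨_, hnorm i⟩
  -- With `a = 0` and `2 = 0` conjugation is trivial, so it only exchanges `s i` with `π ^ i`.
  have h := idealEquiv_conj hf (hnorm i)
  rwa [show -u i - 0 = u i by linear_combination (-u i) * h2] at h

theorem infinite_idealClasses_iff (hπ : Irreducible π) (hf : Irreducible (quadPoly 0 b))
    (h2 : (2 : R) = 0) : Infinite (IdealClasses (QuadOrder 0 b)) ↔
      ∀ i, ∃ u s, IsSolutionAt π b i u s := by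
  have hsol : ∀ i, ∃ p : R × R, (∃ u' s', IsSolutionAt π b i u' s') →
      IsSolutionAt π b i p.1 p.2 := fun i => by
    by_cases h : ∃ u' s', IsSolutionAt π b i u' s'
    · obtain ⟨u, s, h⟩ := h
      exact ⟨(u, s), fun _ => h⟩
    · exact ⟨0, fun h' => absurd h' h⟩
  choose p hp using hsol
  obtain ⟨J, -, hJ⟩ := areAllIdealClasses_inseparable hπ hf h2 (fun i => (p i).1)
    (fun i => (p i).2) hp
  rw [← (Equiv.ofBijective _ hJ).infinite_iff]
  constructor
  · intro hinf i
    -- Levels are closed downwards, so unboundedly many levels give all of them.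
    obtain ⟨j, ⟨u, hj⟩, hij⟩ := (Set.infinite_coe_iff.mp hinf).exists_gt i
    exact ⟨u, (isOrderLevel_iff_exists_isSolutionAt hπ h2).mp
      (((isOrderLevel_iff_exists_isSolutionAt hπ h2).mpr hj).mono hij.le)⟩
  · intro h
    exact Infinite.of_injective (fun i : ℕ => ⟨i, h i⟩) fun i j hij => congrArg Subtype.val hij

end DVR

end QuadOrder


theorem theorem22 {R K : Type*} [CommRing R] [IsDomain R] [IsDiscreteValuationRing R]
    [Field K] [Algebra R K] [IsFractionRing R K]
    (π : R) (hπ : Irreducible π) (a b : R) (hf : Irreducible (quadPoly a b)) :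
    let v := IsDiscreteValuationRing.addVal R
    let ι := algebraMap R (QuadOrder a b)
    let θ := quadRoot a b
    let Sep := ((quadPoly a b).map (algebraMap R K)).Separable
    -- finiteness
    (¬ (CharP K 2 ∧ ¬ Sep) → Finite (IdealClasses (QuadOrder a b))) ∧
    -- `2` is a unit; here `c = a / 2`
    (IsUnit (2 : R) → ∃ c : R, 2 * c = a ∧ ∃ N : ℕ, v (c ^ 2 + b) = N ∧
      AreAllIdealClasses R (fun k : Fin (N / 2 + 1) => ι (π ^ (k : ℕ))) (fun _ => θ - ι c) ∧
      HasClassNumber (QuadOrder a b) (N / 2 + 1)) ∧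
    -- `0 < v(2) = e < ∞`
    (∀ e : ℕ, 0 < e → v 2 = e →
      (v a < e → ∃ m : ℕ, IsGreatest (levelSet a b) m ∧
        (∀ r : R, ((2 * m : ℕ) : ℕ∞) ≤ v (b - r * (r + a)) →
          AreAllIdealClasses R (fun k : Fin (m + 1) => ι (π ^ (k : ℕ))) (fun _ => ι r + θ)) ∧
        HasClassNumber (QuadOrder a b) (m + 1)) ∧
      (e ≤ v a → ∃ c : R, 2 * c = a ∧ ∃ Δ : R, Δ = c ^ 2 + b ∧ (θ - ι c) ^ 2 = ι Δ ∧
        ∃ N : ℕ, v Δ = N ∧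
        (Odd N →
          AreAllIdealClasses R (fun k : Fin (N / 2 + 1) => ι (π ^ (k : ℕ)))
            (fun _ => θ - ι c) ∧
          HasClassNumber (QuadOrder a b) (N / 2 + 1)) ∧
        (Even N → ∃ m : ℕ, IsGreatest (squareLevelSet e Δ) m ∧
          (∀ r : R, ((2 * m : ℕ) : ℕ∞) + v Δ ≤ v (Δ - r ^ 2) →
            AreAllIdealClasses R
              (Sum.elim (fun k : Fin (N / 2 + 1) => ι (π ^ (k : ℕ)))
                (fun i : Fin m => ι (π ^ (N / 2 + ((i : ℕ) + 1)))))
              (Sum.elim (fun _ => θ - ι c) (fun _ => ι r + θ - ι c))) ∧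
          HasClassNumber (QuadOrder a b) (N / 2 + m + 1)))) ∧
    -- characteristic `2`
    ((2 : R) = 0 →
      (Sep → ∃ m : ℕ, IsGreatest (levelSet a b) m ∧
        (∀ r : R, ((2 * m : ℕ) : ℕ∞) ≤ v (b - r * (r + a)) →
          AreAllIdealClasses R (fun k : Fin (m + 1) => ι (π ^ (k : ℕ))) (fun _ => ι r + θ)) ∧
        HasClassNumber (QuadOrder a b) (m + 1)) ∧
      (¬ Sep → a = 0 ∧ ι b = θ ^ 2 ∧
        (∀ u s : ℕ → R,
          (∀ i, (∃ u' s', IsSolutionAt π b i u' s') → IsSolutionAt π b i (u i) (s i)) →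
          AreAllIdealClasses R
            (fun i : {i : ℕ // ∃ u' s', IsSolutionAt π b i u' s'} => ι (s i))
            (fun i => ι (u i) + θ)) ∧
        (Infinite (IdealClasses (QuadOrder a b)) ↔ ∀ i, ∃ u s, IsSolutionAt π b i u s))) := by
  intro v ι θ Sep
  have hunit : IsUnit (2 : R) → ∃ c : R, 2 * c = a ∧ ∃ N : ℕ, v (c ^ 2 + b) = N ∧
      AreAllIdealClasses R (fun k : Fin (N / 2 + 1) => ι (π ^ (k : ℕ))) (fun _ => θ - ι c) ∧
      HasClassNumber (QuadOrder a b) (N / 2 + 1) :=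
    QuadOrder.areAllIdealClasses_isUnit_two hπ hf
  have hlow : ∀ e : ℕ, v 2 = e → v a < e → ∃ m : ℕ, IsGreatest (levelSet a b) m ∧
      (∀ r : R, ((2 * m : ℕ) : ℕ∞) ≤ v (b - r * (r + a)) →
        AreAllIdealClasses R (fun k : Fin (m + 1) => ι (π ^ (k : ℕ))) (fun _ => ι r + θ)) ∧
      HasClassNumber (QuadOrder a b) (m + 1) := by
    intro e he hae
    refine QuadOrder.areAllIdealClasses_levelSet hπ hf ?_ fun r => ?_
    · rintro rfl
      rw [AddValuation.map_zero] at hae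
      exact not_top_lt hae
    · refine AddValuation.map_add_eq_of_lt_right _ (lt_of_lt_of_le hae ?_)
      rw [IsDiscreteValuationRing.addVal_mul, ← he]
      exact le_self_add
  have hhalf : ∀ e : ℕ, v 2 = e → e ≤ v a → ∃ c : R, 2 * c = a := by
    intro e he hea
    rw [← he, IsDiscreteValuationRing.addVal_le_iff_dvd] at hea
    obtain ⟨c, hc⟩ := hea
    exact ⟨c, hc.symm⟩
  have hsep : (2 : R) = 0 → Sep → ∃ m : ℕ, IsGreatest (levelSet a b) m ∧
      (∀ r : R, ((2 * m : ℕ) : ℕ∞) ≤ v (b - r * (r + a)) →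
        AreAllIdealClasses R (fun k : Fin (m + 1) => ι (π ^ (k : ℕ))) (fun _ => ι r + θ)) ∧
      HasClassNumber (QuadOrder a b) (m + 1) := fun h2 hs =>
    QuadOrder.areAllIdealClasses_levelSet hπ hf ((QuadOrder.separable_map_iff (K := K) h2).mp hs)
      fun r => by rw [h2, zero_mul, zero_add]
  refine ⟨fun hfin => ?_, hunit, fun e _ he => ⟨hlow e he, fun hea => ?_⟩,
    fun h2 => ⟨hsep h2, fun hs => ?_⟩⟩
  · by_cases h2 : (2 : R) = 0
    · have hchar : CharP K 2 := CharTwo.of_one_ne_zero_of_two_eq_zero one_ne_zero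
        (by rw [← map_ofNat (algebraMap R K) 2, h2, map_zero])
      obtain ⟨m, -, -, h⟩ := hsep h2 (by_contra fun hs => hfin ⟨hchar, hs⟩)
      exact h.1
    -- Here `e = 0` is allowed, so a unit `2` needs no separate case.
    obtain ⟨e, he⟩ := QuadOrder.exists_addVal_eq h2
    rcases lt_or_ge (v a) e with hae | hea
    · obtain ⟨m, -, -, h⟩ := hlow e he hae
      exact h.1
    obtain ⟨c, hc⟩ := hhalf e he hea
    obtain ⟨N, hN⟩ := QuadOrder.exists_addVal_eq (QuadOrder.disc_ne_zero hf hc)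
    rcases Nat.even_or_odd N with hev | hodd
    · obtain ⟨m, -, -, h⟩ := QuadOrder.areAllIdealClasses_even hπ hf hc hN hev he
      exact h.1
    · exact (QuadOrder.areAllIdealClasses_odd hπ hf hc hN hodd).2.1
  · obtain ⟨c, hc⟩ := hhalf e he hea
    obtain ⟨N, hN⟩ := QuadOrder.exists_addVal_eq (QuadOrder.disc_ne_zero hf hc)
    exact ⟨c, hc, _, rfl, QuadOrder.quadRoot_sub_sq hc, N, hN,
      QuadOrder.areAllIdealClasses_odd hπ hf hc hN,
      fun hev => QuadOrder.areAllIdealClasses_even hπ hf hc hN hev he⟩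
  · obtain rfl : a = 0 := by_contra fun ha => hs ((QuadOrder.separable_map_iff h2).mpr ha)
    refine ⟨rfl, ?_, QuadOrder.areAllIdealClasses_inseparable hπ hf h2,
      QuadOrder.infinite_idealClasses_iff hπ hf h2⟩
    have := QuadOrder.quadRoot_sq 0 b
    rw [map_zero, zero_mul, zero_add] at this
    exact this.symm
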